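/- Let $\varphi(x)=\frac1{\sqrt{2\pi}}e^{-x^2/2}$ be the standard normal density and, for a probability density $p$ on $\mathbb R$, let $$T_\infty(p\|\varphi)=\operatorname*{ess\,sup}_{x\in\mathbb R}\frac{p(x)-\varphi(x)}{\varphi(x)}\in[0,\infty].$$ Let $X$ be a real random variable with $\mathbb E X=0$ and $\operatorname{Var}(X)=1$ that has a density $p$ with $T_\infty(p\|\varphi)<\infty$. Suppose that the Laplace transform $L(t)=\mathbb E e^{tX}$ has the separation property: for every $t_0>0$ there is $\delta=\delta(t_0)\in(0,1)$ such that $$L(t)\le(1-\delta)\,e^{t^2/2}\qquad\text{for all } t\in\mathbb R \text{ with } |t|\ge t_0 .$$ Let $X_1,X_2,\dots$ be independent copies of $X$ and $Z_n=(X_1+\dots+X_n)/\sqrt n$. Then, for every $n\ge1$, $Z_n$ has a density $p_n$, and $T_\infty(p_n\|\varphi)\to0$ as $n\to\infty$. -/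

import Mathlib

open MeasureTheory ProbabilityTheory Filter Topology

noncomputable section

/-- The density of a real random variable `X` with respect to Lebesgue measure, as a real-valued
function (defined up to a null set; meaningful when `X` has a density, i.e. `HasPDF X P volume`). -/
def densityReal {Ω : Type*} [MeasurableSpace Ω] (X : Ω → ℝ) (P : Measure Ω) (x : ℝ) : ℝ :=
  (pdf X P volume x).toReal

/-- Tsallis distance of infinite order of a density `p` to the standard normal density `φ`:
`T_∞(p‖φ) = ess sup_x (p(x) - φ(x)) / φ(x)`, with values in the extended reals, so that the
essential supremum is `⊤` when the ratio is not essentially bounded above. -/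
def tsallisInfty (p : ℝ → ℝ) : EReal :=
  essSup (fun x : ℝ =>
    (((p x - gaussianPDFReal 0 1 x) / gaussianPDFReal 0 1 x : ℝ) : EReal)) volume

/-- The normalized sum `Z_n = (X_1 + ⋯ + X_n) / √n` (the sequence is indexed from `0`). -/
def normalizedSum {Ω : Type*} (X : ℕ → Ω → ℝ) (n : ℕ) (ω : Ω) : ℝ :=
  (∑ k ∈ Finset.range n, X k ω) / Real.sqrt n

/-- The separation property: for every `t₀ > 0` there is `δ ∈ (0, 1)` with
`E exp(tX) ≤ (1 - δ) exp(t² / 2)` whenever `|t| ≥ t₀`. -/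
def SeparationProperty {Ω : Type*} [MeasurableSpace Ω] (X : Ω → ℝ) (P : Measure Ω) : Prop :=
  ∀ t₀ : ℝ, 0 < t₀ → ∃ δ : ℝ, 0 < δ ∧ δ < 1 ∧
    ∀ t : ℝ, t₀ ≤ |t| →
      Integrable (fun ω => Real.exp (t * X ω)) P ∧ mgf X P t ≤ (1 - δ) * Real.exp (t ^ 2 / 2)

end

/-! Finiteness of the Tsallis distance says that the law `μ` of `X` satisfies `μ ≤ C · N(0,1)`. It
is enough to show that the law `σ` of the unnormalized sum satisfies `σ ≤ c_n · N(0,n)`, where c_n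
is eventually at most 1 + c for any given c > 0. Nonnegativity of the distance is automatic, since
both densities have integral 1.

Tilt `σ` by e^{tx}. The Fourier transform of the tilt is L(t+iu)^n, so its density is at most (2π)⁻¹
∫ |L(t+iu)|^n du. If this is at most b e^{nt²/2} for every t, the density of `σ` is at most b
e^{nt²/2 - tx}. Choosing t = x/n gives b e^{-x²/(2n)} (`le_smul_gaussianReal_of_expTilt_le`).

The integral is controlled by `exists_norm_complexMGF_dichotomy`: at each h+iu, either |L| ≤
e^{h²/2} e^{-(1-ε)u²/2} or |L| ≤ (1-δ) e^{h²/2}. The first case contributes a Gaussian integral. In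
the second, n-2 factors decay geometrically and the remaining square is handled by Plancherel,
because the tilt of `μ` has density at most C e^{h²/2}/√(2π). Altogether c_n = (1-ε)^{-1/2} + √n
(1-δ)^{n-2} C.

The dichotomy has three sources: separation when |h| is not small; a Taylor expansion near the
origin; and, for small h with u away from 0, a uniform comparison with the characteristic function,
which Riemann–Lebesgue keeps away from modulus 1. -/

open scoped NNReal ENNReal

/-! ### Density bounds from Gaussian-regularized Fourier inversion and Plancherel -/

/-- The Gaussian average of a modulated characteristic function is a Gaussian smoothing of the
measure. -/
theorem integral_charFun_mul_exp_gaussianReal (ν : Measure ℝ) [IsFiniteMeasure ν] (v : ℝ≥0)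
    (x : ℝ) :
    ∫ u, charFun ν u * Complex.exp (-(u * x) * Complex.I) ∂(gaussianReal 0 v)
      = ((∫ y, Real.exp (-(v * (y - x) ^ 2 / 2)) ∂ν : ℝ) : ℂ) := by
  have h1 : ∀ u : ℝ, charFun ν u * Complex.exp (-(u * x) * Complex.I)
      = ∫ y, Complex.exp (((y - x : ℝ) * u : ℝ) * Complex.I) ∂ν := by
    intro u
    rw [charFun_apply_real, ← integral_mul_const]
    congr 1 with y
    rw [← Complex.exp_add]
    push_cast
    ring_nf
  simp_rw [h1]
  rw [integral_integral_swap]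
  · rw [← integral_complex_ofReal]
    congr 1 with y
    have := charFun_gaussianReal (μ := 0) (v := v) (y - x)
    rw [charFun_apply_real] at this
    push_cast at this ⊢
    rw [this]
    ring_nf
  · refine Integrable.of_bound (C := 1) ?_ ?_
    · apply Measurable.aestronglyMeasurable
      simp only [Function.uncurry_def]
      fun_prop
    · refine ae_of_all _ fun p => ?_
      simp only [Function.uncurry_def]
      rw [Complex.norm_exp_ofReal_mul_I]

theorem integral_exp_neg_sq_le_integral_norm_charFun (ν : Measure ℝ) [IsFiniteMeasure ν]
    (v : ℝ≥0) (x : ℝ) :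
    ∫ y, Real.exp (-(v * (y - x) ^ 2 / 2)) ∂ν ≤ ∫ u, ‖charFun ν u‖ ∂(gaussianReal 0 v) := by
  have h := integral_charFun_mul_exp_gaussianReal ν v x
  have h2 : ‖((∫ y, Real.exp (-(v * (y - x) ^ 2 / 2)) ∂ν : ℝ) : ℂ)‖
      ≤ ∫ u, ‖charFun ν u‖ ∂(gaussianReal 0 v) := by
    rw [← h]
    refine (norm_integral_le_integral_norm _).trans (le_of_eq ?_)
    congr 1 with u
    rw [norm_mul, ← Complex.ofReal_mul, ← Complex.ofReal_neg, Complex.norm_exp_ofReal_mul_I,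
      mul_one]
  rw [Complex.norm_real] at h2
  exact (le_abs_self _).trans h2

/-- Fatou on the product of `ν` with a standard Gaussian: for y in the open set `U`, the perturbed
point y + z/(k+1) eventually lies in `U`. -/
theorem measure_open_le_liminf_gaussian_smoothing (ν : Measure ℝ) [IsFiniteMeasure ν]
    {U : Set ℝ} (hU : IsOpen U) :
    ν U ≤ liminf (fun k : ℕ => ∫⁻ y, gaussianReal y (1 / ((k : ℝ≥0) + 1) ^ 2) U ∂ν) atTop := by
  set f : ℕ → ℝ × ℝ → ℝ≥0∞ := fun k p => U.indicator 1 (p.1 + (1 / ((k : ℝ) + 1)) * p.2) with hf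
  have hmeas : ∀ k, Measurable (f k) := fun k =>
    (measurable_one.indicator hU.measurableSet).comp (by fun_prop)
  have hgauss : ∀ (k : ℕ) (y : ℝ), gaussianReal y (1 / ((k : ℝ≥0) + 1) ^ 2) U
      = ∫⁻ z, f k (y, z) ∂(gaussianReal 0 1) := by
    intro k y
    have h1 : gaussianReal y (1 / ((k : ℝ≥0) + 1) ^ 2)
        = (gaussianReal 0 1).map (fun z => y + (1 / ((k : ℝ) + 1)) * z) := by
      have := gaussianReal_map_const_mul (μ := 0) (v := 1) (1 / ((k : ℝ) + 1))
      have h2 : (gaussianReal 0 1).map (fun z => y + (1 / ((k : ℝ) + 1)) * z)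
          = ((gaussianReal 0 1).map (fun z => (1 / ((k : ℝ) + 1)) * z)).map (fun z => y + z) := by
        rw [Measure.map_map (by fun_prop) (by fun_prop)]
        rfl
      rw [h2, this, gaussianReal_map_const_add]
      congr 1
      · simp
      · ext
        simp
    rw [h1, Measure.map_apply (by fun_prop) hU.measurableSet,
      ← lintegral_indicator_one (hU.measurableSet.preimage (by fun_prop))]
    rfl
  simp_rw [hgauss]
  have hprod : ∀ k, ∫⁻ y, ∫⁻ z, f k (y, z) ∂(gaussianReal 0 1) ∂ν
      = ∫⁻ p, f k p ∂(ν.prod (gaussianReal 0 1)) := fun k =>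
    (lintegral_prod _ (hmeas k).aemeasurable).symm
  simp_rw [hprod]
  refine le_trans ?_ (lintegral_liminf_le hmeas)
  have h0 : ν U = ∫⁻ p : ℝ × ℝ, U.indicator 1 p.1 ∂(ν.prod (gaussianReal 0 1)) := by
    rw [lintegral_prod (fun p : ℝ × ℝ => U.indicator 1 p.1)
      ((measurable_one.indicator hU.measurableSet).comp measurable_fst).aemeasurable]
    simp [lintegral_indicator_one hU.measurableSet]
  rw [h0]
  refine lintegral_mono fun p => ?_
  by_cases hp : p.1 ∈ U
  · have ht : Tendsto (fun k : ℕ => p.1 + (1 / ((k : ℝ) + 1)) * p.2) atTop (𝓝 p.1) := by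
      have := (tendsto_one_div_add_atTop_nhds_zero_nat (𝕜 := ℝ)).mul_const p.2
      simpa using this.const_add p.1
    have hev : ∀ᶠ k in atTop, U.indicator (1 : ℝ → ℝ≥0∞) p.1 ≤ f k p := by
      filter_upwards [ht.eventually (hU.mem_nhds hp)] with k hk
      have hk' : p.1 + (1 / ((k : ℝ) + 1)) * p.2 ∈ U := hk
      simp only [hf]
      rw [Set.indicator_of_mem hk', Set.indicator_of_mem hp]
      simp
    exact le_liminf_of_le (by isBoundedDefault) hev
  · simp [hp]

/-- A finite measure whose characteristic function has (regularized) integral at most `2πB`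
has a density bounded by `B`. -/
theorem le_smul_volume_of_integral_norm_charFun_le (ν : Measure ℝ) [IsFiniteMeasure ν] {B : ℝ}
    -- Since √(2π/v) = 2π (2πv)^{-1/2}, this is the bound 2πB on the Lebesgue integral weighted by
    -- e^{-u²/(2v)}; the weight tends to 1 as v → ∞.
    (h : ∀ v : ℝ≥0, 0 < v →
      ∫ u, ‖charFun ν u‖ ∂(gaussianReal 0 v) ≤ B * √(2 * Real.pi / v)) :
    ν ≤ ENNReal.ofReal B • (volume : Measure ℝ) := by
  have hsm : ∀ (v : ℝ≥0), 0 < v → ∀ U : Set ℝ, MeasurableSet U →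
      ∫⁻ y, gaussianReal y (1 / v) U ∂ν ≤ ENNReal.ofReal B * volume U := by
    intro v hv U hU
    have hv' : (1 / v : ℝ≥0) ≠ 0 := by positivity
    have h1 : ∀ y, gaussianReal y (1 / v) U = ∫⁻ x in U, gaussianPDF y (1 / v) x :=
      fun y => gaussianReal_apply y hv' U
    simp_rw [h1]
    rw [lintegral_lintegral_swap]
    · rw [← setLIntegral_const]
      refine setLIntegral_mono measurable_const fun x _ => ?_
      have hint : Integrable (fun y => Real.exp (-(v * (y - x) ^ 2 / 2))) ν := by
        refine Integrable.of_bound (C := 1) (by fun_prop) (ae_of_all _ fun y => ?_)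
        rw [Real.norm_eq_abs, Real.abs_exp, Real.exp_le_one_iff]
        have : 0 ≤ (v : ℝ) * (y - x) ^ 2 / 2 := by positivity
        linarith
      have hpdf : ∀ y, gaussianPDFReal y (1 / v) x
          = (√(2 * Real.pi / v))⁻¹ * Real.exp (-(v * (y - x) ^ 2 / 2)) := by
        intro y
        rw [gaussianPDFReal]
        have hvr : (v : ℝ) ≠ 0 := by exact_mod_cast hv.ne'
        push_cast
        congr 2
        · congr 1; ring
        · field_simp; ring
      simp only [gaussianPDF, hpdf]
      rw [← ofReal_integral_eq_lintegral_ofReal (hint.const_mul _)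
        (ae_of_all _ fun y => by positivity)]
      apply ENNReal.ofReal_le_ofReal
      rw [integral_const_mul]
      have hpos : 0 < √(2 * Real.pi / v) := by
        have : (0 : ℝ) < v := hv
        positivity
      rw [inv_mul_le_iff₀ hpos, mul_comm]
      exact (integral_exp_neg_sq_le_integral_norm_charFun ν v x).trans (h v hv)
    · apply Measurable.aemeasurable
      exact measurable_uncurry_gaussianPDF.comp
        (by fun_prop : Measurable fun p : ℝ × ℝ => (p.1, (1 / v : ℝ≥0), p.2))
  have hopen : ∀ U : Set ℝ, IsOpen U → ν U ≤ ENNReal.ofReal B * volume U := by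
    intro U hU
    refine (measure_open_le_liminf_gaussian_smoothing ν hU).trans ?_
    refine liminf_le_of_frequently_le' (Frequently.of_forall fun k => ?_)
    exact hsm (((k : ℝ≥0) + 1) ^ 2) (by positivity) U hU.measurableSet
  refine Measure.le_intro fun s hs _ => ?_
  rw [Measure.smul_apply, smul_eq_mul, s.measure_eq_iInf_isOpen volume]
  -- Outer regularity extends the bound from open sets to measurable ones. The case of a zero
  -- constant is separate because a zero factor need not commute with infima when 0 · ∞ occurs.
  by_cases hB : ENNReal.ofReal B = 0
  · have := hopen Set.univ isOpen_univ
    rw [hB, zero_mul] at this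
    exact (measure_mono (Set.subset_univ s)).trans (this.trans bot_le)
  rw [ENNReal.mul_iInf_of_ne hB ENNReal.ofReal_ne_top]
  refine le_iInf fun U => ?_
  rw [ENNReal.mul_iInf_of_ne hB ENNReal.ofReal_ne_top]
  refine le_iInf fun hsU => ?_
  rw [ENNReal.mul_iInf_of_ne hB ENNReal.ofReal_ne_top]
  exact le_iInf fun hU => (measure_mono hsU).trans (hopen U hU)

/-- Gaussian-regularized Plancherel bound for a measure with bounded density. -/
theorem integral_norm_charFun_sq_le (ν : Measure ℝ) [IsFiniteMeasure ν] {K : ℝ} (hK : 0 ≤ K)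
    (h : ν ≤ ENNReal.ofReal K • (volume : Measure ℝ)) (v : ℝ≥0) (hv : 0 < v) :
    ∫ u, ‖charFun ν u‖ ^ 2 ∂(gaussianReal 0 v)
      ≤ K * √(2 * Real.pi / v) * ν.real Set.univ := by
  have hvr : (0 : ℝ) < v := hv
  have hbd : ∀ x, ∫ y, Real.exp (-(v * (y - x) ^ 2 / 2)) ∂ν ≤ K * √(2 * Real.pi / v) := by
    intro x
    have hint : Integrable (fun y => Real.exp (-(v * (y - x) ^ 2 / 2))) volume := by
      have := (integrable_exp_neg_mul_sq (b := (v : ℝ) / 2) (by positivity)).comp_sub_right x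
      refine this.congr (ae_of_all _ fun y => ?_)
      simp only
      congr 1; ring
    have hval : ∫ y, Real.exp (-(v * (y - x) ^ 2 / 2)) = √(2 * Real.pi / v) := by
      have := integral_gaussian ((v : ℝ) / 2)
      rw [← integral_sub_right_eq_self _ x] at this
      rw [show (2 * Real.pi / v) = Real.pi / ((v : ℝ) / 2) by field_simp, ← this]
      congr 1 with y
      congr 1; ring
    calc ∫ y, Real.exp (-(v * (y - x) ^ 2 / 2)) ∂ν
        ≤ ∫ y, Real.exp (-(v * (y - x) ^ 2 / 2)) ∂(ENNReal.ofReal K • (volume : Measure ℝ)) :=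
          integral_mono_measure h (ae_of_all _ fun y => by positivity)
            (hint.smul_measure ENNReal.ofReal_ne_top)
      _ = K * √(2 * Real.pi / v) := by
          rw [integral_smul_measure, hval, ENNReal.toReal_ofReal hK, smul_eq_mul]
  -- Expanding only the conjugate factor leaves a modulated characteristic function, so after Fubini
  -- the smoothing identity applies for each x.
  have hc : ∀ u, ((‖charFun ν u‖ ^ 2 : ℝ) : ℂ)
      = ∫ x, charFun ν u * Complex.exp (-(u * x) * Complex.I) ∂ν := by
    intro u
    rw [integral_const_mul]
    have : charFun ν (-u) = ∫ x, Complex.exp (-(u * x) * Complex.I) ∂ν := by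
      rw [charFun_apply_real]; push_cast; congr 1 with x; ring_nf
    rw [← this, charFun_neg, Complex.mul_conj, Complex.normSq_eq_norm_sq]
  have hswap : ((∫ u, ‖charFun ν u‖ ^ 2 ∂(gaussianReal 0 v) : ℝ) : ℂ)
      = ((∫ x, ∫ y, Real.exp (-(v * (y - x) ^ 2 / 2)) ∂ν ∂ν : ℝ) : ℂ) := by
    rw [← integral_complex_ofReal]
    simp_rw [hc]
    rw [integral_integral_swap]
    · simp_rw [integral_charFun_mul_exp_gaussianReal]
      rw [integral_complex_ofReal]
    · refine Integrable.of_bound (C := ν.real Set.univ) ?_ (ae_of_all _ fun p => ?_)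
      · apply Measurable.aestronglyMeasurable
        simp only [Function.uncurry_def]
        have : Measurable (charFun ν) := measurable_charFun
        fun_prop
      · simp only [Function.uncurry_def]
        rw [norm_mul, ← Complex.ofReal_mul, ← Complex.ofReal_neg, Complex.norm_exp_ofReal_mul_I,
          mul_one]
        exact norm_charFun_le _
  rw [Complex.ofReal_inj.1 hswap]
  calc ∫ x, ∫ y, Real.exp (-(v * (y - x) ^ 2 / 2)) ∂ν ∂ν
      ≤ ∫ _, K * √(2 * Real.pi / v) ∂ν :=
        integral_mono_of_nonneg (ae_of_all _ fun x => integral_nonneg fun y => by positivity)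
          (integrable_const _) (ae_of_all _ hbd)
    _ = K * √(2 * Real.pi / v) * ν.real Set.univ := by
        rw [integral_const, smul_eq_mul, mul_comm]

/-! ### Elementary pointwise inequalities -/

theorem abs_exp_sub_one_le_mul_exp_abs (t : ℝ) : |Real.exp t - 1| ≤ |t| * Real.exp |t| := by
  rcases le_or_gt 0 t with ht | ht
  · rw [abs_of_nonneg ht, abs_of_nonneg (by linarith [Real.one_le_exp ht])]
    have h1 := Real.add_one_le_exp (-t)
    have h2 : Real.exp (-t) * Real.exp t = 1 := by rw [← Real.exp_add]; simp
    nlinarith [Real.exp_pos t]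
  · rw [abs_of_nonpos (by linarith [Real.exp_le_one_iff.2 ht.le]), abs_of_neg ht]
    have h1 := Real.add_one_le_exp t
    have h2 := Real.one_le_exp (x := -t) (by linarith)
    nlinarith

theorem abs_sin_sub_self_le (t : ℝ) : |Real.sin t - t| ≤ 2 * t ^ 2 := by
  rcases le_or_gt |t| 1 with ht | ht
  · have h := Real.sin_bound ht
    have h3 : |t ^ 3 / 6| ≤ t ^ 2 := by
      rw [abs_div, abs_pow, abs_of_pos (by norm_num : (0 : ℝ) < 6), ← sq_abs t]
      nlinarith [abs_nonneg t, sq_nonneg |t|]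
    have h4 : |t| ^ 5 / 100 ≤ t ^ 2 := by
      rw [← sq_abs t]
      have := pow_le_pow_of_le_one (abs_nonneg t) ht (by norm_num : 2 ≤ 5)
      nlinarith [sq_nonneg |t|]
    have := abs_le.1 h
    have := abs_le.1 h3
    rw [abs_le]
    constructor <;> linarith
  · have h1 : |Real.sin t| ≤ |t| := Real.abs_sin_le_abs
    have h2 := abs_sub (Real.sin t) t
    rw [← sq_abs t]
    nlinarith

theorem cos_le_one_sub_sq_add_pow (t : ℝ) : Real.cos t ≤ 1 - t ^ 2 / 2 + t ^ 4 / 2 := by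
  rcases le_or_gt |t| 1 with ht | ht
  · have h := (abs_le.1 (Real.cos_bound ht)).2
    have h4 : |t| ^ 4 = t ^ 4 := by rw [← abs_pow, abs_of_nonneg (by positivity)]
    rw [h4] at h
    have : 0 ≤ t ^ 4 := by positivity
    linarith
  · have h1 : 1 ≤ t ^ 2 := by rw [← sq_abs]; nlinarith
    have := Real.cos_le_one t
    nlinarith

/-- One factor e^{|x|} absorbs the power and another absorbs e^{hx}; thus the single moment K = ∫
e^{2|x|} controls all the Taylor remainders below. -/
theorem abs_pow_mul_exp_le {h : ℝ} (hh : |h| ≤ 1) (k : ℕ) (x : ℝ) :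
    |x| ^ k * Real.exp (h * x) ≤ k.factorial * Real.exp (2 * |x|) := by
  have h1 := Real.pow_div_factorial_le_exp |x| (abs_nonneg x) k
  have h2 : Real.exp (h * x) ≤ Real.exp |x| := by
    apply Real.exp_le_exp.2
    have := le_abs_self (h * x)
    rw [abs_mul] at this
    nlinarith [abs_nonneg x]
  rw [div_le_iff₀ (by positivity)] at h1
  calc |x| ^ k * Real.exp (h * x) ≤ (Real.exp |x| * k.factorial) * Real.exp |x| := by gcongr
    _ = k.factorial * Real.exp (2 * |x|) := by rw [two_mul, Real.exp_add]; ring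

theorem abs_pow_mul_abs_exp_sub_one_le {h : ℝ} (hh : |h| ≤ 1) (k : ℕ) (x : ℝ) :
    |x| ^ k * |Real.exp (h * x) - 1| ≤ |h| * ((k + 1).factorial * Real.exp (2 * |x|)) := by
  have h1 := abs_exp_sub_one_le_mul_exp_abs (h * x)
  have h2 : Real.exp |h * x| ≤ Real.exp |x| := by
    apply Real.exp_le_exp.2
    rw [abs_mul]
    nlinarith [abs_nonneg x]
  have h3 := abs_pow_mul_exp_le (h := 1) (by simp) (k + 1) |x|
  rw [abs_abs, one_mul] at h3
  calc |x| ^ k * |Real.exp (h * x) - 1| ≤ |x| ^ k * (|h * x| * Real.exp |x|) := by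
        gcongr; exact h1.trans (by gcongr)
    _ = |h| * (|x| ^ (k + 1) * Real.exp |x|) := by rw [abs_mul]; ring
    _ ≤ _ := by gcongr

/-- Here w = u², and A, B are the real and imaginary parts. The square of the correction in A and
the term B² cost wκ each; with E(1-κ) ≤ 1, the total loss in the coefficient of w is at most 4κE².
-/
theorem sq_add_sq_le_of_quadratic_bounds {κ E w A B : ℝ} (hκ0 : 0 < κ) (hκ1 : κ ≤ 1 / 4)
    (hE1 : 1 ≤ E) (hEκ : E * (1 - κ) ≤ 1) (hw0 : 0 ≤ w) (hw : w ≤ κ) (hA0 : 0 ≤ A)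
    (hA : A ≤ E - w / 2 * (1 - κ)) (hB : B ^ 2 ≤ w * κ) :
    A ^ 2 + B ^ 2 ≤ E ^ 2 * (1 - (1 - 4 * κ) * w) := by
  have hA2 : A ^ 2 ≤ E ^ 2 - E * w * (1 - κ) + w * κ := by
    have h3 : A ^ 2 ≤ (E - w / 2 * (1 - κ)) ^ 2 := by gcongr
    have h4 : (w / 2 * (1 - κ)) ^ 2 ≤ w * κ := by
      have h5 : (1 - κ) ^ 2 ≤ 1 := by nlinarith
      calc (w / 2 * (1 - κ)) ^ 2 = w * w / 4 * (1 - κ) ^ 2 := by ring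
        _ ≤ w * w / 4 * 1 := by gcongr
        _ ≤ w * κ := by nlinarith
    calc A ^ 2 ≤ (E - w / 2 * (1 - κ)) ^ 2 := h3
      _ = E ^ 2 - E * w * (1 - κ) + (w / 2 * (1 - κ)) ^ 2 := by ring
      _ ≤ _ := by gcongr
  have h3 : E ^ 2 * (1 - 4 * κ) ≤ E * (1 - κ) - 2 * κ := by
    have h4 : E ^ 2 * (1 - κ) ≤ E := by nlinarith
    have h5 : E ^ 2 * (1 - κ) * (1 - κ) ≤ E * (1 - κ) := by gcongr; linarith
    have h7 : 2 * κ ≤ E ^ 2 * (2 * κ) := le_mul_of_one_le_left (by positivity) (by nlinarith)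
    have h8 : 0 ≤ E ^ 2 * κ ^ 2 := by positivity
    calc E ^ 2 * (1 - 4 * κ)
        = E ^ 2 * (1 - κ) * (1 - κ) - E ^ 2 * (2 * κ) - E ^ 2 * κ ^ 2 := by ring
      _ ≤ _ := by linarith
  have h4 := mul_le_mul_of_nonneg_left h3 hw0
  linarith

/-! ### Taylor estimates for the complex moment generating function near the origin -/

section Moments

variable {μ : Measure ℝ}

theorem integrable_pow_mul_exp_of_integrable_exp_abs
    (hK : Integrable (fun x => Real.exp (2 * |x|)) μ) {h : ℝ} (hh : |h| ≤ 1) (k : ℕ) :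
    Integrable (fun x => x ^ k * Real.exp (h * x)) μ := by
  refine (hK.const_mul (k.factorial : ℝ)).mono' (by fun_prop) (ae_of_all _ fun x => ?_)
  rw [Real.norm_eq_abs, abs_mul, abs_pow, Real.abs_exp]
  exact abs_pow_mul_exp_le hh k x

theorem integrable_pow_of_integrable_exp_abs
    (hK : Integrable (fun x => Real.exp (2 * |x|)) μ) (k : ℕ) :
    Integrable (fun x => x ^ k) μ := by
  simpa using integrable_pow_mul_exp_of_integrable_exp_abs hK (h := 0) (by simp) k

theorem integrable_exp_of_integrable_exp_abs
    (hK : Integrable (fun x => Real.exp (2 * |x|)) μ) {h : ℝ} (hh : |h| ≤ 1) :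
    Integrable (fun x => Real.exp (h * x)) μ := by
  simpa using integrable_pow_mul_exp_of_integrable_exp_abs hK hh 0

theorem norm_cexp_strip (h u x : ℝ) :
    ‖Complex.exp ((h + u * Complex.I) * x)‖ = Real.exp (h * x) := by
  rw [Complex.norm_exp]
  congr 1
  simp

theorem integrable_cexp_strip {h : ℝ} (hh : Integrable (fun x => Real.exp (h * x)) μ) (u : ℝ) :
    Integrable (fun x : ℝ => Complex.exp ((h + u * Complex.I) * x)) μ :=
  hh.mono' (by fun_prop) (ae_of_all _ fun x => (norm_cexp_strip h u x).le)

/-- The two integrands share the phase e^{iux} and differ only by the factor e^{hx} - 1, which makes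
the bound uniform in u. -/
theorem norm_complexMGF_sub_charFun_le (hK : Integrable (fun x => Real.exp (2 * |x|)) μ)
    [IsFiniteMeasure μ] {h : ℝ} (hh : |h| ≤ 1) (u : ℝ) :
    ‖complexMGF id μ (h + u * Complex.I) - charFun μ u‖ ≤ |h| * ∫ x, Real.exp (2 * |x|) ∂μ := by
  have hi0 : Integrable (fun x : ℝ => Complex.exp (u * x * Complex.I)) μ :=
    Integrable.of_bound (C := 1) (by fun_prop) (ae_of_all _ fun x => by
      rw [← Complex.ofReal_mul, Complex.norm_exp_ofReal_mul_I])
  rw [charFun_apply_real, complexMGF]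
  simp only [id]
  rw [← integral_sub (integrable_cexp_strip (integrable_exp_of_integrable_exp_abs hK hh) u) hi0,
    ← integral_const_mul]
  refine norm_integral_le_of_norm_le (hK.const_mul _) (ae_of_all _ fun x => ?_)
  have : Complex.exp ((h + u * Complex.I) * x) - Complex.exp (u * x * Complex.I)
      = ((Real.exp (h * x) - 1 : ℝ) : ℂ) * Complex.exp ((u * x : ℝ) * Complex.I) := by
    push_cast
    rw [sub_mul, ← Complex.exp_add, one_mul]
    ring_nf
  rw [this, norm_mul, Complex.norm_exp_ofReal_mul_I, mul_one, Complex.norm_real, Real.norm_eq_abs]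
  simpa using abs_pow_mul_abs_exp_sub_one_le hh 0 x

theorem re_complexMGF_strip {h : ℝ} (hh : Integrable (fun x => Real.exp (h * x)) μ) (u : ℝ) :
    (complexMGF id μ (h + u * Complex.I)).re = ∫ x, Real.exp (h * x) * Real.cos (u * x) ∂μ := by
  rw [complexMGF]
  simp only [id]
  change Complex.reCLM _ = _
  rw [← ContinuousLinearMap.integral_comp_comm _ (integrable_cexp_strip hh u)]
  congr 1 with x
  simp [Complex.exp_re]

theorem im_complexMGF_strip {h : ℝ} (hh : Integrable (fun x => Real.exp (h * x)) μ) (u : ℝ) :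
    (complexMGF id μ (h + u * Complex.I)).im = ∫ x, Real.exp (h * x) * Real.sin (u * x) ∂μ := by
  rw [complexMGF]
  simp only [id]
  change Complex.imCLM _ = _
  rw [← ContinuousLinearMap.integral_comp_comm _ (integrable_cexp_strip hh u)]
  congr 1 with x
  simp [Complex.exp_im]

theorem integrable_exp_mul_of_abs_le_one {h : ℝ} (hh : Integrable (fun x => Real.exp (h * x)) μ)
    {g : ℝ → ℝ} (hg : Measurable g) (hb : ∀ x, |g x| ≤ 1) :
    Integrable (fun x => Real.exp (h * x) * g x) μ := by
  refine hh.mono' (by fun_prop) (ae_of_all _ fun x => ?_)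
  rw [Real.norm_eq_abs, abs_mul, Real.abs_exp]
  exact mul_le_of_le_one_right (Real.exp_pos _).le (hb x)

theorem one_le_integral_exp_two_abs [IsProbabilityMeasure μ]
    (hK : Integrable (fun x => Real.exp (2 * |x|)) μ) :
    1 ≤ ∫ x, Real.exp (2 * |x|) ∂μ := by
  calc (1 : ℝ) = ∫ _, 1 ∂μ := by simp
    _ ≤ _ := integral_mono (integrable_const _) hK fun x => Real.one_le_exp (by positivity)

theorem one_sub_le_integral_sq_mul_exp (hK : Integrable (fun x => Real.exp (2 * |x|)) μ)
    (h2 : ∫ x, x ^ 2 ∂μ = 1) {h : ℝ} (hh : |h| ≤ 1) :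
    1 - 6 * |h| * ∫ x, Real.exp (2 * |x|) ∂μ ≤ ∫ x, x ^ 2 * Real.exp (h * x) ∂μ := by
  rw [← h2, ← integral_const_mul,
    ← integral_sub (integrable_pow_of_integrable_exp_abs hK 2) (hK.const_mul _)]
  refine integral_mono ((integrable_pow_of_integrable_exp_abs hK 2).sub (hK.const_mul _))
    (integrable_pow_mul_exp_of_integrable_exp_abs hK hh 2) fun x => ?_
  have := abs_pow_mul_abs_exp_sub_one_le hh 2 x
  norm_num [Nat.factorial] at this
  have h3 := neg_abs_le (Real.exp (h * x) - 1)
  simp only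
  nlinarith [sq_nonneg x]

/-- Integrates cos s ≤ 1 - s²/2 + s⁴/2 at s = ux against e^{hx}. The constants are 12 = 4!/2 and 6 =
3!, the latter from replacing the tilted second moment by 1. -/
theorem re_complexMGF_strip_le (hK : Integrable (fun x => Real.exp (2 * |x|)) μ)
    (h2 : ∫ x, x ^ 2 ∂μ = 1) {h : ℝ} (hh : |h| ≤ 1) (u : ℝ) :
    (complexMGF id μ (h + u * Complex.I)).re ≤ mgf id μ h
      - u ^ 2 / 2 * (1 - 6 * |h| * ∫ x, Real.exp (2 * |x|) ∂μ)
      + 12 * u ^ 4 * ∫ x, Real.exp (2 * |x|) ∂μ := by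
  have he := integrable_exp_of_integrable_exp_abs hK hh
  have hp := integrable_pow_mul_exp_of_integrable_exp_abs hK hh 2
  rw [re_complexMGF_strip he]
  calc ∫ x, Real.exp (h * x) * Real.cos (u * x) ∂μ
      ≤ ∫ x, (Real.exp (h * x) - u ^ 2 / 2 * (x ^ 2 * Real.exp (h * x))
          + 12 * u ^ 4 * Real.exp (2 * |x|)) ∂μ := by
        refine integral_mono
          (integrable_exp_mul_of_abs_le_one he (by fun_prop) fun x => Real.abs_cos_le_one _)
          ((he.sub (hp.const_mul _)).add (hK.const_mul _)) fun x => ?_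
        have hx := abs_pow_mul_exp_le hh 4 x
        norm_num [Nat.factorial] at hx
        rw [← abs_pow, abs_of_nonneg (by positivity : 0 ≤ x ^ 4)] at hx
        have hc := mul_le_mul_of_nonneg_left (cos_le_one_sub_sq_add_pow (u * x))
          (Real.exp_pos (h * x)).le
        have hu : 0 ≤ u ^ 4 := by positivity
        have := mul_le_mul_of_nonneg_left hx hu
        simp only
        nlinarith
    _ = mgf id μ h - u ^ 2 / 2 * ∫ x, x ^ 2 * Real.exp (h * x) ∂μ
          + 12 * u ^ 4 * ∫ x, Real.exp (2 * |x|) ∂μ := by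
        have hsub : Integrable
            (fun x => Real.exp (h * x) - u ^ 2 / 2 * (x ^ 2 * Real.exp (h * x))) μ :=
          he.sub (hp.const_mul _)
        rw [integral_add hsub (hK.const_mul _),
          integral_sub he (hp.const_mul _), integral_const_mul, integral_const_mul, mgf]
        rfl
    _ ≤ _ := by
        have := one_sub_le_integral_sq_mul_exp hK h2 hh
        gcongr

theorem one_le_mgf_of_integral_eq_zero [IsProbabilityMeasure μ]
    (hK : Integrable (fun x => Real.exp (2 * |x|)) μ)
    (h1 : ∫ x, x ∂μ = 0) {h : ℝ} (hh : |h| ≤ 1) : 1 ≤ mgf id μ h := by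
  have hi : Integrable (fun x : ℝ => x) μ := by
    simpa using integrable_pow_of_integrable_exp_abs hK 1
  calc (1 : ℝ) = ∫ x, (h * x + 1) ∂μ := by
        rw [integral_add (hi.const_mul _) (integrable_const _), integral_const_mul, h1]; simp
    _ ≤ mgf id μ h :=
        integral_mono ((hi.const_mul _).add (integrable_const _))
          (integrable_exp_of_integrable_exp_abs hK hh) fun x => Real.add_one_le_exp _

/-- Serves only to make the real part nonnegative near the origin, so that its upper bound can be
squared. -/
theorem le_re_complexMGF_strip [IsProbabilityMeasure μ]
    (hK : Integrable (fun x => Real.exp (2 * |x|)) μ)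
    (h1 : ∫ x, x ∂μ = 0) {h : ℝ} (hh : |h| ≤ 1) (u : ℝ) :
    1 - u ^ 2 * ∫ x, Real.exp (2 * |x|) ∂μ ≤ (complexMGF id μ (h + u * Complex.I)).re := by
  have he := integrable_exp_of_integrable_exp_abs hK hh
  rw [re_complexMGF_strip he]
  calc 1 - u ^ 2 * ∫ x, Real.exp (2 * |x|) ∂μ
      ≤ mgf id μ h - u ^ 2 * ∫ x, Real.exp (2 * |x|) ∂μ := by
        gcongr; exact one_le_mgf_of_integral_eq_zero hK h1 hh
    _ = ∫ x, (Real.exp (h * x) - u ^ 2 * Real.exp (2 * |x|)) ∂μ := by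
        rw [integral_sub he (hK.const_mul _), integral_const_mul, mgf]; rfl
    _ ≤ _ := by
        refine integral_mono (he.sub (hK.const_mul _))
          (integrable_exp_mul_of_abs_le_one he (by fun_prop) fun x => Real.abs_cos_le_one _)
          fun x => ?_
        have hx := abs_pow_mul_exp_le hh 2 x
        norm_num [Nat.factorial] at hx
        have hc := mul_le_mul_of_nonneg_left (Real.one_sub_sq_div_two_le_cos (x := u * x))
          (Real.exp_pos (h * x)).le
        have := mul_le_mul_of_nonneg_left hx (sq_nonneg u)
        simp only
        nlinarith

/-- Zero mean allows ux to be subtracted from the integrand, which removes the term linear in u at h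
= 0. What remains is |u| times a quantity small with h and u, so its square is a small multiple of
u². -/
theorem abs_im_complexMGF_strip_le (hK : Integrable (fun x => Real.exp (2 * |x|)) μ)
    (h1 : ∫ x, x ∂μ = 0) (h2 : ∫ x, x ^ 2 ∂μ = 1) {h : ℝ} (hh : |h| ≤ 1) (u : ℝ) :
    |(complexMGF id μ (h + u * Complex.I)).im|
      ≤ |u| * (2 * |h| * ∫ x, Real.exp (2 * |x|) ∂μ + 2 * |u|) := by
  have he := integrable_exp_of_integrable_exp_abs hK hh
  have hs := integrable_exp_mul_of_abs_le_one he (g := fun x => Real.sin (u * x)) (by fun_prop)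
    fun x => Real.abs_sin_le_one _
  have hi : Integrable (fun x : ℝ => x) μ := by
    simpa using integrable_pow_of_integrable_exp_abs hK 1
  have hi2 := integrable_pow_of_integrable_exp_abs hK 2
  rw [im_complexMGF_strip he]
  have h0 : ∫ x, Real.exp (h * x) * Real.sin (u * x) ∂μ
      = ∫ x, (Real.exp (h * x) * Real.sin (u * x) - u * x) ∂μ := by
    rw [integral_sub hs (hi.const_mul _), integral_const_mul, h1]; simp
  rw [h0, ← Real.norm_eq_abs]
  calc ‖∫ x, (Real.exp (h * x) * Real.sin (u * x) - u * x) ∂μ‖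
      ≤ ∫ x, (|u| * (2 * |h|) * Real.exp (2 * |x|) + 2 * u ^ 2 * x ^ 2) ∂μ := by
        refine norm_integral_le_of_norm_le ((hK.const_mul _).add (hi2.const_mul _))
          (ae_of_all _ fun x => ?_)
        have hx := abs_pow_mul_abs_exp_sub_one_le hh 1 x
        norm_num [Nat.factorial] at hx
        have ha : |(Real.exp (h * x) - 1) * Real.sin (u * x)|
            ≤ |u| * (|x| * |Real.exp (h * x) - 1|) := by
          rw [abs_mul]
          have := Real.abs_sin_le_abs (x := u * x)
          rw [abs_mul] at this
          nlinarith [abs_nonneg (Real.exp (h * x) - 1)]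
        have hb := abs_sin_sub_self_le (u * x)
        have hsplit : Real.exp (h * x) * Real.sin (u * x) - u * x
            = (Real.exp (h * x) - 1) * Real.sin (u * x) + (Real.sin (u * x) - u * x) := by ring
        rw [Real.norm_eq_abs, hsplit]
        have := mul_le_mul_of_nonneg_left hx (abs_nonneg u)
        calc _ ≤ _ := abs_add_le _ _
          _ ≤ _ := add_le_add (ha.trans this) hb
          _ = _ := by ring
    _ = _ := by
        rw [integral_add (hK.const_mul _) (hi2.const_mul _), integral_const_mul,
          integral_const_mul, h2, ← sq_abs u]
        ring

/-- Near the origin of the strip, the complex moment generating function of a standardized law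
with `mgf ≤ exp (h² / 2)` is dominated by an almost standard Gaussian. -/
theorem norm_complexMGF_le_near_zero [IsProbabilityMeasure μ]
    (hK : Integrable (fun x => Real.exp (2 * |x|)) μ)
    (h1 : ∫ x, x ∂μ = 0) (h2 : ∫ x, x ^ 2 ∂μ = 1)
    (hL : ∀ h, mgf id μ h ≤ Real.exp (h ^ 2 / 2)) {ε : ℝ} (hε : 0 < ε) (hε1 : ε < 1) :
    ∃ η > 0, ∀ h u : ℝ, |h| ≤ η → |u| ≤ η →
      ‖complexMGF id μ (h + u * Complex.I)‖
        ≤ Real.exp (h ^ 2 / 2) * Real.exp (-((1 - ε) * u ^ 2 / 2)) := by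
  set K := ∫ x, Real.exp (2 * |x|) ∂μ with hKdef
  have hK1 : 1 ≤ K := one_le_integral_exp_two_abs hK
  -- 30 = 6 + 24: the relative error in the quadratic term of the real part is 6|h|K + 24u²K, and
  -- ε/4 is the κ of `sq_add_sq_le_of_quadratic_bounds`.
  obtain ⟨η, hη, hηκ⟩ : ∃ η > 0, 30 * η * K = ε / 4 :=
    ⟨ε / (120 * K), by positivity, by field_simp; norm_num⟩
  refine ⟨η, hη, fun h u hh hu => ?_⟩
  set κ := ε / 4 with hκ
  have hη1 : 30 * η ≤ κ := by nlinarith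
  have hηκ' : η ≤ κ := by linarith
  have hηle : η ≤ 1 := by linarith
  have hh1 : |h| ≤ 1 := hh.trans hηle
  have hu0 := abs_nonneg u
  have hh0 := abs_nonneg h
  have hu2 : u ^ 2 ≤ η := by rw [← sq_abs]; nlinarith
  have hh2 : h ^ 2 ≤ η := by rw [← sq_abs]; nlinarith
  have hu20 : 0 ≤ u ^ 2 := sq_nonneg u
  have hA := re_complexMGF_strip_le hK h2 hh1 u
  have hA0 := le_re_complexMGF_strip hK h1 hh1 u
  have hB := abs_im_complexMGF_strip_le hK h1 h2 hh1 u
  rw [← hKdef] at hA hA0 hB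
  set A := (complexMGF id μ (h + u * Complex.I)).re with hAdef
  set B := (complexMGF id μ (h + u * Complex.I)).im with hBdef
  set E := Real.exp (h ^ 2 / 2) with hE
  have hE1 : 1 ≤ E := Real.one_le_exp (by positivity)
  have hEu : E * (1 - κ) ≤ 1 := by
    have h3 := Real.add_one_le_exp (-(h ^ 2 / 2))
    have h4 : E * Real.exp (-(h ^ 2 / 2)) = 1 := by rw [hE, ← Real.exp_add]; simp
    nlinarith
  have hhK : |h| * K ≤ η * K := by gcongr
  have huK : u ^ 2 * K ≤ η * K := by gcongr
  have hA0' : 0 ≤ A := by linarith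
  have hA' : A ≤ E - u ^ 2 / 2 * (1 - κ) := by
    have := hL h
    have h3 : 6 * |h| * K + 24 * u ^ 2 * K ≤ κ := by linarith
    nlinarith
  have hB2 : B ^ 2 ≤ u ^ 2 * κ := by
    have h3 : |B| ≤ |u| * κ := hB.trans (by gcongr; nlinarith)
    have h4 : B ^ 2 ≤ (|u| * κ) ^ 2 := by rw [← sq_abs B]; gcongr
    rw [mul_pow, sq_abs] at h4
    have : κ ^ 2 ≤ κ := by nlinarith
    nlinarith
  have hsq : ‖complexMGF id μ (h + u * Complex.I)‖ ^ 2 ≤ E ^ 2 * (1 - (1 - ε) * u ^ 2) := by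
    rw [← Complex.normSq_eq_norm_sq, Complex.normSq_apply, ← hAdef, ← hBdef, ← sq, ← sq,
      show ε = 4 * κ by rw [hκ]; ring]
    exact sq_add_sq_le_of_quadratic_bounds (by positivity) (by linarith) hE1 hEu hu20
      (hu2.trans hηκ') hA0' hA' hB2
  have hexp : E ^ 2 * (1 - (1 - ε) * u ^ 2)
      ≤ (E * Real.exp (-((1 - ε) * u ^ 2 / 2))) ^ 2 := by
    have he : Real.exp (-((1 - ε) * u ^ 2 / 2)) ^ 2 = Real.exp (-((1 - ε) * u ^ 2)) := by
      rw [← Real.exp_nat_mul]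
      congr 1
      push_cast
      ring
    rw [mul_pow, he]
    gcongr
    linarith [Real.add_one_le_exp (-((1 - ε) * u ^ 2))]
  exact (sq_le_sq₀ (norm_nonneg _) (by positivity)).1 (hsq.trans hexp)

end Moments

/-! ### Decay away from the origin and the dichotomy -/

section Decay

variable {μ : Measure ℝ} [IsProbabilityMeasure μ]

/-- Modulus 1 would force cos(ux - θ) = 1 almost surely, with θ the argument; this confines the law
to a countable set, which is Lebesgue-null. -/
theorem norm_charFun_lt_one_of_absolutelyContinuous (hac : μ ≪ volume) {u : ℝ} (hu : u ≠ 0) :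
    ‖charFun μ u‖ < 1 := by
  refine lt_of_le_of_ne (norm_charFun_le_one u) fun hone => ?_
  set θ := (charFun μ u).arg with hθ
  have hi : Integrable (fun x : ℝ => Complex.exp (((u * x - θ : ℝ) : ℂ) * Complex.I)) μ :=
    Integrable.of_bound (C := 1) (by fun_prop) (ae_of_all _ fun x => by
      rw [Complex.norm_exp_ofReal_mul_I])
  have hrot : ∫ x, Complex.exp (((u * x - θ : ℝ) : ℂ) * Complex.I) ∂μ = 1 := by
    have h1 : ∀ x : ℝ, Complex.exp (((u * x - θ : ℝ) : ℂ) * Complex.I)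
        = Complex.exp (u * x * Complex.I) * Complex.exp (-(θ * Complex.I)) := fun x => by
      rw [← Complex.exp_add]; push_cast; ring_nf
    simp_rw [h1]
    rw [integral_mul_const, ← charFun_apply_real]
    nth_rw 1 [← Complex.norm_mul_exp_arg_mul_I (charFun μ u)]
    rw [hone, ← hθ, Complex.ofReal_one, one_mul, ← Complex.exp_add, add_neg_cancel,
      Complex.exp_zero]
  have hcos : ∫ x, Real.cos (u * x - θ) ∂μ = 1 := by
    have h1 := congrArg Complex.reCLM hrot
    rw [← ContinuousLinearMap.integral_comp_comm _ hi] at h1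
    simpa only [Complex.reCLM_apply, Complex.exp_ofReal_mul_I_re, Complex.one_re] using h1
  have hci : Integrable (fun x : ℝ => Real.cos (u * x - θ)) μ :=
    Integrable.of_bound (C := 1) (by fun_prop) (ae_of_all _ fun x => Real.abs_cos_le_one _)
  have hz : ∫ x, (1 - Real.cos (u * x - θ)) ∂μ = 0 := by
    rw [integral_sub (integrable_const _) hci, hcos]; simp
  rw [integral_eq_zero_iff_of_nonneg (fun x => sub_nonneg.2 (Real.cos_le_one _))
    ((integrable_const _).sub hci)] at hz
  have hsub : {x : ℝ | Real.cos (u * x - θ) = 1} ⊆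
      Set.range fun n : ℤ => (n * (2 * Real.pi) + θ) / u := by
    intro x hx
    obtain ⟨n, hn⟩ := (Real.cos_eq_one_iff _).1 hx
    exact ⟨n, by simp only; rw [hn]; field_simp; ring⟩
  have hnull : μ {x : ℝ | Real.cos (u * x - θ) = 1} = 0 :=
    hac (((Set.countable_range _).mono hsub).measure_zero _)
  have hfalse : ∀ᵐ x ∂μ, False := by
    filter_upwards [hz, measure_eq_zero_iff_ae_notMem.1 hnull] with x hx hx'
    exact hx' (sub_eq_zero.1 hx).symm
  simp at hfalse
  exact IsProbabilityMeasure.ne_zero μ hfalse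

/-- Riemann–Lebesgue for the density; the factor -(2π)⁻¹ converts between the two Fourier
conventions. -/
theorem tendsto_charFun_cocompact_of_absolutelyContinuous (hac : μ ≪ volume) :
    Tendsto (charFun μ) (cocompact ℝ) (𝓝 0) := by
  set f : ℝ → ℂ := fun x => ((μ.rnDeriv volume x).toReal : ℂ) with hf
  have hRL := Real.tendsto_integral_exp_smul_cocompact f
  have hscale : Tendsto (fun u : ℝ => (-(2 * Real.pi)⁻¹) * u) (cocompact ℝ) (cocompact ℝ) :=
    (Homeomorph.mulLeft₀ (-(2 * Real.pi)⁻¹)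
      (by simp [Real.pi_ne_zero])).isClosedEmbedding.tendsto_cocompact
  refine (hRL.comp hscale).congr fun u => ?_
  rw [Function.comp_apply, charFun_apply_real]
  have h1 := integral_rnDeriv_smul (E := ℂ) hac (f := fun x : ℝ => Complex.exp (u * x * Complex.I))
  rw [← h1]
  congr 1 with x
  rw [Circle.smul_def, Real.fourierChar_apply, hf, smul_eq_mul, Complex.real_smul, mul_comm]
  congr 2
  push_cast
  have : (Real.pi : ℂ) ≠ 0 := by exact_mod_cast Real.pi_ne_zero
  field_simp

/-- The characteristic function of an absolutely continuous law is bounded away from `1`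
outside every neighbourhood of the origin. -/
theorem exists_norm_charFun_le_one_sub (hac : μ ≪ volume) {u₀ : ℝ} (hu₀ : 0 < u₀) :
    ∃ δ > 0, ∀ u : ℝ, u₀ ≤ |u| → ‖charFun μ u‖ ≤ 1 - δ := by
  have hdec := tendsto_charFun_cocompact_of_absolutelyContinuous hac
  have hev : ∀ᶠ u in cocompact ℝ, ‖charFun μ u‖ < 1 / 2 := by
    have := hdec.norm
    rw [norm_zero] at this
    exact this.eventually_lt_const (by norm_num)
  obtain ⟨S, hS, hSsub⟩ := mem_cocompact.1 hev
  have hcomp : IsCompact (S ∩ {u | u₀ ≤ |u|}) :=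
    hS.inter_right (isClosed_le continuous_const continuous_abs)
  rcases (S ∩ {u | u₀ ≤ |u|}).eq_empty_or_nonempty with hemp | hne
  · refine ⟨1 / 2, by norm_num, fun u hu => ?_⟩
    have : u ∉ S := fun h => by
      have : u ∈ S ∩ {u | u₀ ≤ |u|} := ⟨h, hu⟩
      simp [hemp] at this
    have h2 : ‖charFun μ u‖ < 1 / 2 := hSsub this
    linarith
  · obtain ⟨w, hw, hmax⟩ := hcomp.exists_isMaxOn hne
      (continuous_charFun (μ := μ)).norm.continuousOn
    have hw0 : w ≠ 0 := fun h => by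
      have := hw.2
      simp [h] at this
      linarith
    have hlt := norm_charFun_lt_one_of_absolutelyContinuous hac hw0
    refine ⟨min (1 / 2) (1 - ‖charFun μ w‖), lt_min (by norm_num) (by linarith), fun u hu => ?_⟩
    by_cases huS : u ∈ S
    · have h2 : ‖charFun μ u‖ ≤ ‖charFun μ w‖ := hmax ⟨huS, hu⟩
      linarith [min_le_right (1 / 2) (1 - ‖charFun μ w‖)]
    · have h2 : ‖charFun μ u‖ < 1 / 2 := hSsub huS
      linarith [min_le_left (1 / 2) (1 - ‖charFun μ w‖)]

theorem mgf_le_of_separation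
    (hsep : ∀ t₀ : ℝ, 0 < t₀ → ∃ δ : ℝ, 0 < δ ∧ δ < 1 ∧ ∀ t : ℝ, t₀ ≤ |t| →
      mgf id μ t ≤ (1 - δ) * Real.exp (t ^ 2 / 2)) (h : ℝ) :
    mgf id μ h ≤ Real.exp (h ^ 2 / 2) := by
  by_cases hh : h = 0
  · simp [hh]
  · obtain ⟨δ, hδ, _, H⟩ := hsep |h| (abs_pos.2 hh)
    exact (H h le_rfl).trans (mul_le_of_le_one_left (by positivity) (by linarith))

/-- Dichotomy for the complex moment generating function of a standardized law with the
separation property. -/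
theorem exists_norm_complexMGF_dichotomy (hac : μ ≪ volume)
    (hK : Integrable (fun x => Real.exp (2 * |x|)) μ)
    (h1 : ∫ x, x ∂μ = 0) (h2 : ∫ x, x ^ 2 ∂μ = 1)
    (hsep : ∀ t₀ : ℝ, 0 < t₀ → ∃ δ : ℝ, 0 < δ ∧ δ < 1 ∧ ∀ t : ℝ, t₀ ≤ |t| →
      mgf id μ t ≤ (1 - δ) * Real.exp (t ^ 2 / 2))
    {ε : ℝ} (hε : 0 < ε) (hε1 : ε < 1) :
    ∃ δ > 0, δ < 1 ∧ ∀ h u : ℝ,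
      ‖complexMGF id μ (h + u * Complex.I)‖
          ≤ Real.exp (h ^ 2 / 2) * Real.exp (-((1 - ε) * u ^ 2 / 2)) ∨
      ‖complexMGF id μ (h + u * Complex.I)‖ ≤ (1 - δ) * Real.exp (h ^ 2 / 2) := by
  have hL := mgf_le_of_separation hsep
  obtain ⟨η, hη, hnear⟩ := norm_complexMGF_le_near_zero hK h1 h2 hL hε hε1
  obtain ⟨δ₁, hδ₁, hfar⟩ := exists_norm_charFun_le_one_sub hac hη
  set K := ∫ x, Real.exp (2 * |x|) ∂μ with hKdef
  have hK1 : 1 ≤ K := one_le_integral_exp_two_abs hK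
  -- Below this threshold the near-origin estimate is available, and passing from `charFun` to the
  -- tilt costs at most δ₁/2, half of the gap.
  set t₀ := min (min η 1) (δ₁ / (2 * K)) with ht₀
  have ht₀pos : 0 < t₀ := by positivity
  obtain ⟨δ₂, hδ₂, hδ₂1, hlarge⟩ := hsep t₀ ht₀pos
  refine ⟨min δ₂ (δ₁ / 2), by positivity, (min_le_left _ _).trans_lt hδ₂1, fun h u => ?_⟩
  rcases le_or_gt t₀ |h| with hh | hh
  · right
    have h3 := norm_complexMGF_le_mgf (X := id) (μ := μ) (z := h + u * Complex.I)
    have hre : ((h : ℂ) + u * Complex.I).re = h := by simp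
    rw [hre] at h3
    refine h3.trans ((hlarge h hh).trans ?_)
    gcongr
    exact min_le_left _ _
  · have hhη : |h| ≤ η := hh.le.trans ((min_le_left _ _).trans (min_le_left _ _))
    have hh1 : |h| ≤ 1 := hh.le.trans ((min_le_left _ _).trans (min_le_right _ _))
    rcases le_or_gt |u| η with hu | hu
    · exact Or.inl (hnear h u hhη hu)
    · right
      have h3 := norm_complexMGF_sub_charFun_le hK hh1 u
      rw [← hKdef] at h3
      have h4 : |h| * K ≤ δ₁ / 2 := by
        have : |h| ≤ δ₁ / (2 * K) := hh.le.trans (min_le_right _ _)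
        calc |h| * K ≤ δ₁ / (2 * K) * K := by gcongr
          _ = δ₁ / 2 := by field_simp
      have h5 := hfar u hu.le
      have h6 := norm_sub_norm_le (complexMGF id μ (h + u * Complex.I)) (charFun μ u)
      have h7 : ‖complexMGF id μ (h + u * Complex.I)‖ ≤ 1 - min δ₂ (δ₁ / 2) := by
        linarith [min_le_right δ₂ (δ₁ / 2)]
      refine h7.trans (le_mul_of_one_le_right ?_ (Real.one_le_exp (by positivity)))
      linarith [min_le_left δ₂ (δ₁ / 2)]

end Decay

/-! ### Exponential tilting -/

/-- Unnormalized exponential tilting of a measure on the line. -/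
noncomputable def expTilt (ρ : Measure ℝ) (h : ℝ) : Measure ℝ :=
  ρ.withDensity fun x => ENNReal.ofReal (Real.exp (h * x))

theorem isFiniteMeasure_expTilt {ρ : Measure ℝ} {h : ℝ}
    (hi : Integrable (fun x => Real.exp (h * x)) ρ) : IsFiniteMeasure (expTilt ρ h) :=
  isFiniteMeasure_withDensity_ofReal hi.2

theorem expTilt_zero (ρ : Measure ℝ) : expTilt ρ 0 = ρ := by
  simp [expTilt]

theorem charFun_expTilt (ρ : Measure ℝ) (h u : ℝ) :
    charFun (expTilt ρ h) u = complexMGF id ρ (h + u * Complex.I) := by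
  rw [charFun_apply_real, expTilt, complexMGF,
    integral_withDensity_eq_integral_toReal_smul (by fun_prop) (ae_of_all _ fun x => by simp)]
  congr 1 with x
  rw [ENNReal.toReal_ofReal (Real.exp_pos _).le, Complex.real_smul, Complex.ofReal_exp,
    ← Complex.exp_add]
  simp only [id]
  push_cast
  ring_nf

theorem measureReal_univ_expTilt {ρ : Measure ℝ} {h : ℝ}
    (hi : Integrable (fun x => Real.exp (h * x)) ρ) :
    (expTilt ρ h).real Set.univ = mgf id ρ h := by
  rw [Measure.real, expTilt, withDensity_apply _ MeasurableSet.univ, Measure.restrict_univ,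
    ← ofReal_integral_eq_lintegral_ofReal hi (ae_of_all _ fun x => (Real.exp_pos _).le),
    ENNReal.toReal_ofReal (integral_nonneg fun x => (Real.exp_pos _).le), mgf]
  rfl

/-- Completing the square: hx - x²/2 ≤ h²/2. -/
theorem expTilt_le_smul_volume {μ : Measure ℝ} {C : ℝ} (hC : 0 ≤ C)
    (hμ : μ ≤ ENNReal.ofReal C • gaussianReal 0 1) (h : ℝ) :
    expTilt μ h ≤ ENNReal.ofReal (C / √(2 * Real.pi) * Real.exp (h ^ 2 / 2)) •
      (volume : Measure ℝ) := by
  refine Measure.le_intro fun s hs _ => ?_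
  rw [expTilt, withDensity_apply _ hs, Measure.smul_apply, smul_eq_mul]
  calc ∫⁻ x in s, ENNReal.ofReal (Real.exp (h * x)) ∂μ
      ≤ ∫⁻ x in s, ENNReal.ofReal (Real.exp (h * x)) ∂(ENNReal.ofReal C • gaussianReal 0 1) :=
        lintegral_mono' (Measure.restrict_mono le_rfl hμ) le_rfl
    _ = ENNReal.ofReal C * ∫⁻ x in s, gaussianPDF 0 1 x * ENNReal.ofReal (Real.exp (h * x)) := by
        rw [Measure.restrict_smul, lintegral_smul_measure, smul_eq_mul,
          gaussianReal_of_var_ne_zero _ one_ne_zero,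
          setLIntegral_withDensity_eq_setLIntegral_mul _ (measurable_gaussianPDF _ _)
            (by fun_prop) hs]
        rfl
    _ ≤ ENNReal.ofReal C * ∫⁻ _ in s,
          ENNReal.ofReal ((√(2 * Real.pi))⁻¹ * Real.exp (h ^ 2 / 2)) := by
        gcongr with x
        rw [gaussianPDF, ← ENNReal.ofReal_mul (gaussianPDFReal_nonneg _ _ _)]
        apply ENNReal.ofReal_le_ofReal
        rw [gaussianPDFReal, mul_assoc, ← Real.exp_add]
        simp only [NNReal.coe_one, mul_one, sub_zero]
        gcongr
        nlinarith [sq_nonneg (x - h)]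
    _ = _ := by
        rw [setLIntegral_const, ← mul_assoc, ← ENNReal.ofReal_mul hC]
        congr 2
        ring

/-- The Gaussian density is replaced by its peak (2πv)^{-1/2} = √(2π/v)/(2π), the normalization
required by the inversion bound. -/
theorem integral_exp_neg_mul_sq_gaussianReal_le {b : ℝ} (hb : 0 < b) {v : ℝ≥0} (hv : 0 < v) :
    ∫ u, Real.exp (-b * u ^ 2) ∂(gaussianReal 0 v)
      ≤ √(2 * Real.pi / v) * (√(Real.pi / b) / (2 * Real.pi)) := by
  have hvr : (0 : ℝ) < v := hv
  have hc : (√(2 * Real.pi * v))⁻¹ = √(2 * Real.pi / v) / (2 * Real.pi) := by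
    rw [show 2 * Real.pi / (v : ℝ) = (2 * Real.pi) ^ 2 / (2 * Real.pi * v) by field_simp,
      Real.sqrt_div' _ (by positivity), Real.sqrt_sq (by positivity)]
    field_simp
  rw [integral_gaussianReal_eq_integral_smul hv.ne']
  calc ∫ u, gaussianPDFReal 0 v u • Real.exp (-b * u ^ 2)
      ≤ ∫ u, (√(2 * Real.pi * v))⁻¹ * Real.exp (-b * u ^ 2) := by
        refine integral_mono_of_nonneg
          (ae_of_all _ fun u => mul_nonneg (gaussianPDFReal_nonneg _ _ _) (Real.exp_pos _).le)
          ((integrable_exp_neg_mul_sq hb).const_mul _) (ae_of_all _ fun u => ?_)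
        simp only [smul_eq_mul]
        gcongr
        rw [gaussianPDFReal]
        refine mul_le_of_le_one_right (by positivity) (Real.exp_le_one_iff.2 ?_)
        rw [neg_div]
        have : 0 ≤ (u - 0) ^ 2 / (2 * (v : ℝ)) := by positivity
        linarith
    _ = _ := by
        rw [integral_const_mul, integral_gaussian, hc]
        ring

/-! ### Gaussian domination of the law of the sum -/

section Sum

variable {μ σ : Measure ℝ}

/-- The constant bounding the tilted densities of a sum of `n` terms. -/
noncomputable def tiltBound (C ε δ : ℝ) (n : ℕ) : ℝ :=
  √(2 * Real.pi / (n * (1 - ε))) / (2 * Real.pi) + (1 - δ) ^ (n - 2) * (C / √(2 * Real.pi))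

/-- Adding the bounds from the two alternatives avoids splitting the domain in u. In the Plancherel
term one factor E comes from the density bound and another from the total mass, restoring the full
power E^n. -/
theorem integral_norm_charFun_expTilt_le {C : ℝ} (hC : 0 ≤ C)
    (hμ : μ ≤ ENNReal.ofReal C • gaussianReal 0 1)
    {h : ℝ} (hi : Integrable (fun x => Real.exp (h * x)) μ)
    (hL : mgf id μ h ≤ Real.exp (h ^ 2 / 2)) {ε δ : ℝ} (hε1 : ε < 1) (hδ1 : δ < 1)
    (hdich : ∀ u : ℝ, ‖complexMGF id μ (h + u * Complex.I)‖
          ≤ Real.exp (h ^ 2 / 2) * Real.exp (-((1 - ε) * u ^ 2 / 2)) ∨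
      ‖complexMGF id μ (h + u * Complex.I)‖ ≤ (1 - δ) * Real.exp (h ^ 2 / 2))
    {n : ℕ} (hn : 2 ≤ n) {v : ℝ≥0} (hv : 0 < v) :
    ∫ u, ‖complexMGF id μ (h + u * Complex.I)‖ ^ n ∂(gaussianReal 0 v)
      ≤ Real.exp (h ^ 2 / 2) ^ n * tiltBound C ε δ n * √(2 * Real.pi / v) := by
  set E := Real.exp (h ^ 2 / 2) with hE
  have hE0 : 0 < E := Real.exp_pos _
  have : IsFiniteMeasure (expTilt μ h) := isFiniteMeasure_expTilt hi
  have hn0 : (0 : ℝ) < n := by exact_mod_cast (by omega : 0 < n)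
  have hε' : 0 < 1 - ε := by linarith
  have hδ' : 0 < 1 - δ := by linarith
  set b : ℝ := n * (1 - ε) / 2 with hb
  have hb0 : 0 < b := by positivity
  simp_rw [← charFun_expTilt] at hdich ⊢
  have hpl := integral_norm_charFun_sq_le (expTilt μ h) (by positivity)
    (expTilt_le_smul_volume hC hμ h) v hv
  rw [measureReal_univ_expTilt hi] at hpl
  have hg := integral_exp_neg_mul_sq_gaussianReal_le hb0 hv
  have hmeas : Measurable (charFun (expTilt μ h)) := measurable_charFun
  have hsq : Integrable (fun u => ‖charFun (expTilt μ h) u‖ ^ 2) (gaussianReal 0 v) :=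
    Integrable.of_bound (C := (expTilt μ h).real Set.univ ^ 2) (by fun_prop)
      (ae_of_all _ fun u => by
        rw [norm_pow, norm_norm]
        gcongr
        exact norm_charFun_le u)
  have hge : Integrable (fun u => Real.exp (-b * u ^ 2)) (gaussianReal 0 v) :=
    Integrable.of_bound (C := 1) (by fun_prop) (ae_of_all _ fun u => by
      rw [Real.norm_eq_abs, Real.abs_exp, Real.exp_le_one_iff]
      nlinarith [sq_nonneg u])
  have hpt : ∀ u, ‖charFun (expTilt μ h) u‖ ^ n
      ≤ E ^ n * Real.exp (-b * u ^ 2)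
        + (1 - δ) ^ (n - 2) * E ^ (n - 2) * ‖charFun (expTilt μ h) u‖ ^ 2 := by
    intro u
    rcases hdich u with H | H
    · have h1 : ‖charFun (expTilt μ h) u‖ ^ n ≤ E ^ n * Real.exp (-b * u ^ 2) := by
        calc _ ≤ (E * Real.exp (-((1 - ε) * u ^ 2 / 2))) ^ n := by gcongr
          _ = _ := by
            rw [mul_pow, ← Real.exp_nat_mul (-((1 - ε) * u ^ 2 / 2))]
            congr 2
            rw [hb]
            ring
      exact h1.trans (le_add_of_nonneg_right (by positivity))
    · have h1 : ‖charFun (expTilt μ h) u‖ ^ n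
          ≤ (1 - δ) ^ (n - 2) * E ^ (n - 2) * ‖charFun (expTilt μ h) u‖ ^ 2 := by
        rw [← mul_pow]
        nth_rw 1 [← Nat.sub_add_cancel hn]
        rw [pow_add]
        gcongr
      exact h1.trans (le_add_of_nonneg_left (by positivity))
  calc ∫ u, ‖charFun (expTilt μ h) u‖ ^ n ∂(gaussianReal 0 v)
      ≤ ∫ u, (E ^ n * Real.exp (-b * u ^ 2)
        + (1 - δ) ^ (n - 2) * E ^ (n - 2) * ‖charFun (expTilt μ h) u‖ ^ 2) ∂(gaussianReal 0 v) :=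
        integral_mono_of_nonneg (ae_of_all _ fun u => by positivity)
          ((hge.const_mul _).add (hsq.const_mul _)) (ae_of_all _ hpt)
    _ = E ^ n * ∫ u, Real.exp (-b * u ^ 2) ∂(gaussianReal 0 v)
        + (1 - δ) ^ (n - 2) * E ^ (n - 2) *
          ∫ u, ‖charFun (expTilt μ h) u‖ ^ 2 ∂(gaussianReal 0 v) := by
        rw [integral_add (hge.const_mul _) (hsq.const_mul _), integral_const_mul,
          integral_const_mul]
    _ ≤ E ^ n * (√(2 * Real.pi / v) * (√(Real.pi / b) / (2 * Real.pi)))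
        + (1 - δ) ^ (n - 2) * E ^ (n - 2) *
          (C / √(2 * Real.pi) * E * √(2 * Real.pi / v) * E) := by
        gcongr
        exact hpl.trans (by gcongr)
    _ = _ := by
        have h1 : Real.pi / b = 2 * Real.pi / (n * (1 - ε)) := by rw [hb]; field_simp
        have h2 : E ^ n = E ^ (n - 2) * E ^ 2 := by rw [← pow_add, Nat.sub_add_cancel hn]
        rw [h1, h2, tiltBound]
        ring

/-- A measure all of whose exponential tilts have densities bounded as those of a centred
Gaussian of variance `n` is dominated by that Gaussian. -/
theorem le_smul_gaussianReal_of_expTilt_le [IsFiniteMeasure σ] {b : ℝ} (hb : 0 ≤ b) {n : ℕ} (hn : 0 < n)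
    (h : ∀ t : ℝ, expTilt σ t ≤ ENNReal.ofReal (Real.exp (t ^ 2 / 2) ^ n * b) •
      (volume : Measure ℝ)) :
    σ ≤ ENNReal.ofReal (b * √(2 * Real.pi * n)) • gaussianReal 0 n := by
  have hn0 : (0 : ℝ) < n := by exact_mod_cast hn
  have hnn : (n : ℝ≥0) ≠ 0 := by exact_mod_cast hn.ne'
  have hac : σ ≪ volume := by
    have := h 0
    rw [expTilt_zero] at this
    exact (Measure.absolutelyContinuous_of_le this).trans Measure.smul_absolutelyContinuous
  set f := σ.rnDeriv volume with hf
  have hfm : Measurable f := Measure.measurable_rnDeriv _ _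
  have hσ : volume.withDensity f = σ := Measure.withDensity_rnDeriv_eq _ _ hac
  have hq : ∀ t : ℝ, ∀ᵐ x, f x * ENNReal.ofReal (Real.exp (t * x))
      ≤ ENNReal.ofReal (Real.exp (t ^ 2 / 2) ^ n * b) := by
    intro t
    refine ae_le_of_forall_setLIntegral_le_of_sigmaFinite (by fun_prop) fun s hs _ => ?_
    have h1 := h t s
    rw [expTilt, withDensity_apply _ hs, ← hσ,
      setLIntegral_withDensity_eq_setLIntegral_mul _ hfm (by fun_prop) hs, Measure.smul_apply,
      smul_eq_mul] at h1
    rw [setLIntegral_const]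
    exact h1
  -- The exceptional null set depends on t, so it is fixed for rational t first; continuity in t
  -- then gives all real t at once, as needed for a t depending on x.
  have hall : ∀ᵐ x, ∀ q : ℚ, f x * ENNReal.ofReal (Real.exp (q * x))
      ≤ ENNReal.ofReal (Real.exp ((q : ℝ) ^ 2 / 2) ^ n * b) := ae_all_iff.2 fun q => hq q
  have hbound : ∀ᵐ x, f x ≤ ENNReal.ofReal (b * √(2 * Real.pi * n)) * gaussianPDF 0 n x := by
    filter_upwards [hall] with x hx
    have hx' : ∀ t : ℝ,
        f x ≤ ENNReal.ofReal (Real.exp (t ^ 2 / 2) ^ n * b * Real.exp (-(t * x))) := by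
      intro t
      refine Rat.denseRange_cast.induction_on
        (p := fun t : ℝ =>
          f x ≤ ENNReal.ofReal (Real.exp (t ^ 2 / 2) ^ n * b * Real.exp (-(t * x))))
        t ?_ fun q => ?_
      · refine isClosed_le continuous_const (ENNReal.continuous_ofReal.comp (by fun_prop))
      · rw [ENNReal.ofReal_mul (by positivity)]
        calc f x = f x * ENNReal.ofReal (Real.exp (q * x))
              * ENNReal.ofReal (Real.exp (-(q * x))) := by
              rw [mul_assoc, ← ENNReal.ofReal_mul (by positivity), ← Real.exp_add]
              simp
          _ ≤ _ := by gcongr; exact hx q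
    -- t = x/n minimizes nt²/2 - tx, with value -x²/(2n).
    refine (hx' (x / n)).trans (le_of_eq ?_)
    rw [gaussianPDF, ← ENNReal.ofReal_mul (by positivity), gaussianPDFReal, ← Real.exp_nat_mul]
    congr 1
    have hs : √(2 * Real.pi * n) ≠ 0 := by positivity
    push_cast
    rw [mul_comm _ b, mul_assoc, mul_assoc, ← Real.exp_add, ← mul_assoc (√(2 * Real.pi * n)),
      mul_inv_cancel₀ hs, one_mul]
    congr 2
    field_simp
    ring
  rw [gaussianReal_of_var_ne_zero _ hnn, ← withDensity_smul _ (measurable_gaussianPDF _ _),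
    ← hσ]
  exact withDensity_mono hbound

theorem le_smul_gaussianReal_of_complexMGF_eq_pow [IsFiniteMeasure σ] {C : ℝ} (hC : 0 ≤ C)
    (hμ : μ ≤ ENNReal.ofReal C • gaussianReal 0 1)
    (hi : ∀ h, Integrable (fun x => Real.exp (h * x)) μ)
    (hL : ∀ h, mgf id μ h ≤ Real.exp (h ^ 2 / 2)) {ε δ : ℝ} (hε1 : ε < 1) (hδ1 : δ < 1)
    (hdich : ∀ h u : ℝ, ‖complexMGF id μ (h + u * Complex.I)‖
          ≤ Real.exp (h ^ 2 / 2) * Real.exp (-((1 - ε) * u ^ 2 / 2)) ∨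
      ‖complexMGF id μ (h + u * Complex.I)‖ ≤ (1 - δ) * Real.exp (h ^ 2 / 2))
    {n : ℕ} (hn : 2 ≤ n)
    (hσi : ∀ h, Integrable (fun x => Real.exp (h * x)) σ)
    (hσ : ∀ z, complexMGF id σ z = complexMGF id μ z ^ n) :
    σ ≤ ENNReal.ofReal ((√(1 - ε))⁻¹ + √n * (1 - δ) ^ (n - 2) * C) • gaussianReal 0 n := by
  have hn0 : (0 : ℝ) < n := by exact_mod_cast (by omega : 0 < n)
  have hε' : 0 < 1 - ε := by linarith
  have hδ' : 0 < 1 - δ := by linarith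
  have hb : 0 ≤ tiltBound C ε δ n := by unfold tiltBound; positivity
  have h1 : tiltBound C ε δ n * √(2 * Real.pi * n)
      = (√(1 - ε))⁻¹ + √n * (1 - δ) ^ (n - 2) * C := by
    have e1 : √(2 * Real.pi / (n * (1 - ε))) * √(2 * Real.pi * n)
        = 2 * Real.pi * (√(1 - ε))⁻¹ := by
      rw [← Real.sqrt_mul (by positivity), ← Real.sqrt_inv,
        show 2 * Real.pi / (n * (1 - ε)) * (2 * Real.pi * n)
          = (2 * Real.pi) ^ 2 * (1 - ε)⁻¹ by field_simp,
        Real.sqrt_mul (by positivity), Real.sqrt_sq (by positivity)]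
    have e2 : √(2 * Real.pi * n) = √(2 * Real.pi) * √n := Real.sqrt_mul (by positivity) _
    rw [tiltBound, add_mul, div_mul_eq_mul_div, e1, e2]
    have : √(2 * Real.pi) ≠ 0 := by positivity
    field_simp
  rw [← h1]
  refine le_smul_gaussianReal_of_expTilt_le hb (by omega) fun t => ?_
  have : IsFiniteMeasure (expTilt σ t) := isFiniteMeasure_expTilt (hσi t)
  refine le_smul_volume_of_integral_norm_charFun_le _ fun v hv => ?_
  simp_rw [charFun_expTilt, hσ, norm_pow]
  exact integral_norm_charFun_expTilt_le hC hμ (hi t) (hL t) hε1 hδ1 (hdich t) hn hv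

end Sum

/-! ### Tsallis distance as domination by the Gaussian -/

section Tsallis

variable {Ω : Type*} [MeasurableSpace Ω] {P : Measure Ω} {X : Ω → ℝ}

theorem exists_map_le_smul_gaussianReal_of_tsallisInfty_lt_top [IsFiniteMeasure P]
    (hX : HasPDF X P volume)
    (hT : tsallisInfty (densityReal X P) < ⊤) :
    ∃ C : ℝ, 0 ≤ C ∧ P.map X ≤ ENNReal.ofReal C • gaussianReal 0 1 := by
  obtain ⟨c, hc, -⟩ := EReal.lt_iff_exists_real_btwn.1 hT
  refine ⟨max (1 + c) 0, le_max_right _ _, ?_⟩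
  have hae := ae_lt_of_essSup_lt hc
  rw [map_eq_withDensity_pdf X P volume, gaussianReal_of_var_ne_zero _ one_ne_zero,
    ← withDensity_smul _ (measurable_gaussianPDF _ _)]
  refine withDensity_mono ?_
  have htop : _ =ᵐ[volume] pdf X P volume := pdf.ofReal_toReal_ae_eq
  filter_upwards [hae, htop] with x hx hx2
  have hpos := gaussianPDFReal_pos 0 1 x one_ne_zero
  have h1 : densityReal X P x ≤ max (1 + c) 0 * gaussianPDFReal 0 1 x := by
    have h2 := EReal.coe_lt_coe_iff.1 hx
    rw [div_lt_iff₀ hpos] at h2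
    have h3 := mul_le_mul_of_nonneg_right (le_max_left (1 + c) 0) hpos.le
    linarith
  rw [← hx2, Pi.smul_apply, smul_eq_mul, gaussianPDF, ← ENNReal.ofReal_mul (le_max_right _ _)]
  exact ENNReal.ofReal_le_ofReal h1

theorem tsallisInfty_le_of_map_le_smul_gaussianReal (hX : HasPDF X P volume) {c : ℝ}
    (hc : -1 ≤ c) (h : P.map X ≤ ENNReal.ofReal (1 + c) • gaussianReal 0 1) :
    tsallisInfty (densityReal X P) ≤ c := by
  have hae : ∀ᵐ x, pdf X P volume x ≤ ENNReal.ofReal (1 + c) * gaussianPDF 0 1 x := by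
    have hm := measurable_gaussianPDF 0 1
    refine ae_le_of_forall_setLIntegral_le_of_sigmaFinite (measurable_pdf _ _ _)
      fun s hs _ => ?_
    rw [← map_eq_setLIntegral_pdf X P volume hs, lintegral_const_mul _ hm,
      ← gaussianReal_apply _ one_ne_zero]
    exact h s
  refine essSup_le_of_ae_le _ ?_
  filter_upwards [hae] with x hx
  have hpos := gaussianPDFReal_pos 0 1 x one_ne_zero
  rw [EReal.coe_le_coe_iff, div_le_iff₀ hpos]
  have h1 : densityReal X P x ≤ (1 + c) * gaussianPDFReal 0 1 x := by
    rw [gaussianPDF, ← ENNReal.ofReal_mul (by linarith)] at hx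
    exact ENNReal.toReal_le_of_le_ofReal (mul_nonneg (by linarith) hpos.le) hx
  linarith

/-- A negative value would put the density strictly below the Gaussian almost everywhere, although
both have integral 1. -/
theorem tsallisInfty_nonneg [IsProbabilityMeasure P] (hX : HasPDF X P volume) :
    0 ≤ tsallisInfty (densityReal X P) := by
  by_contra! hneg
  have hae := ae_lt_of_essSup_lt hneg
  have hlt : ∀ᵐ x, densityReal X P x < gaussianPDFReal 0 1 x := by
    filter_upwards [hae] with x hx
    have hpos := gaussianPDFReal_pos 0 1 x one_ne_zero
    have h2 := EReal.coe_lt_coe_iff.1 hx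
    rw [div_lt_iff₀ hpos] at h2
    linarith
  have hone : ∫⁻ x, pdf X P volume x = 1 := by
    rw [pdf.lintegral_eq_measure_univ, measure_univ]
  have hi : Integrable (densityReal X P) volume :=
    integrable_toReal_of_lintegral_ne_top (measurable_pdf _ _ _).aemeasurable (by simp [hone])
  have hp : ∫ x, densityReal X P x = 1 := by
    unfold densityReal
    rw [integral_toReal (measurable_pdf _ _ _).aemeasurable pdf.ae_lt_top, hone]
    simp
  have hz : ∫ x, (gaussianPDFReal 0 1 x - densityReal X P x) = 0 := by
    rw [integral_sub (integrable_gaussianPDFReal _ _) hi,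
      integral_gaussianPDFReal_eq_one _ one_ne_zero, hp, sub_self]
  rw [integral_eq_zero_iff_of_nonneg_ae (hlt.mono fun x hx => sub_nonneg.2 hx.le)
    ((integrable_gaussianPDFReal _ _).sub hi)] at hz
  have hfalse : ∀ᵐ _ : ℝ, False := by
    filter_upwards [hz, hlt] with x hx hx'
    exact (sub_pos.2 hx').ne' hx
  simp at hfalse
  exact NeZero.ne (volume : Measure ℝ) hfalse

end Tsallis

/-! ### Sums of independent copies -/

section Sums

variable {Ω : Type*} [MeasurableSpace Ω] {P : Measure Ω} {Y : ℕ → Ω → ℝ} {μ : Measure ℝ}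

theorem map_normalizedSum (hY : ∀ k, AEMeasurable (Y k) P) (n : ℕ) :
    P.map (normalizedSum Y n)
      = (P.map fun ω => ∑ k ∈ Finset.range n, Y k ω).map (fun x => x / √n) := by
  rw [AEMeasurable.map_map_of_aemeasurable (by fun_prop) (by fun_prop)]
  rfl

theorem hasPDF_normalizedSum (hindep : iIndepFun Y P) (hY : ∀ k, AEMeasurable (Y k) P)
    (hac : ∀ k, P.map (Y k) ≪ volume) {n : ℕ} (hn : 1 ≤ n) :
    HasPDF (normalizedSum Y n) P volume := by
  have := hindep.isProbabilityMeasure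
  have hm : AEMeasurable (normalizedSum Y n) P := by unfold normalizedSum; fun_prop
  rw [Real.hasPDF_iff_of_aemeasurable hm, map_normalizedSum hY]
  have hsum : (P.map fun ω => ∑ k ∈ Finset.range n, Y k ω) ≪ volume := by
    obtain ⟨m, rfl⟩ := Nat.exists_eq_add_of_le' hn
    have h1 : (fun ω => ∑ k ∈ Finset.range (m + 1), Y k ω)
        = (∑ k ∈ Finset.range m, Y k) + Y m := by
      ext ω
      simp [Finset.sum_range_succ]
    have hind := hindep.indepFun_finsetSum_of_notMem₀ hY (Finset.notMem_range_self (n := m))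
    rw [h1, hind.map_add_eq_map_conv_map₀ (by fun_prop) (hY m)]
    -- Absolute continuity of the last summand alone suffices, whatever the law of the others.
    exact Measure.conv_absolutelyContinuous (hac m)
  have hs : (√n)⁻¹ ≠ 0 := by
    have : (0 : ℝ) < n := by exact_mod_cast hn
    positivity
  have hg : Measurable fun x : ℝ => x / √n := by fun_prop
  refine (hsum.map hg).trans ?_
  simp_rw [div_eq_mul_inv]
  rw [Real.map_volume_mul_right hs]
  exact Measure.smul_absolutelyContinuous

theorem complexMGF_map_sum (hindep : iIndepFun Y P) (hY : ∀ k, AEMeasurable (Y k) P)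
    (hlaw : ∀ k, P.map (Y k) = μ) (n : ℕ) (z : ℂ) :
    complexMGF id (P.map fun ω => ∑ k ∈ Finset.range n, Y k ω) z = complexMGF id μ z ^ n := by
  rw [complexMGF_id_map (by fun_prop), complexMGF]
  have hsub : iIndepFun (fun i : Fin n => Y i) P := hindep.precomp Fin.val_injective
  have h1 := hsub.integral_fun_prod_comp (f := fun _ (x : ℝ) => Complex.exp (z * x))
    (fun i => hY i) (fun i => by fun_prop)
  have h2 : ∀ ω, Complex.exp (z * ((∑ k ∈ Finset.range n, Y k ω : ℝ) : ℂ))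
      = ∏ i : Fin n, Complex.exp (z * Y i ω) := by
    intro ω
    rw [Finset.sum_range, ← Complex.exp_sum]
    push_cast
    rw [Finset.mul_sum]
  simp_rw [h2]
  refine h1.trans ?_
  have h3 : ∀ k, ∫ ω, Complex.exp (z * Y k ω) ∂P = complexMGF id μ z := by
    intro k
    rw [← hlaw k, complexMGF_id_map (hY k), complexMGF]
  simp [h3]

/-- Without integrability the `mgf` of the sum would take its default value 0, contradicting the
product formula, whose right-hand side is positive. -/
theorem integrable_exp_map_sum (hindep : iIndepFun Y P) (hY : ∀ k, AEMeasurable (Y k) P)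
    (hlaw : ∀ k, P.map (Y k) = μ) {t : ℝ} (hi : Integrable (fun x => Real.exp (t * x)) μ) (n : ℕ) :
    Integrable (fun x => Real.exp (t * x)) (P.map fun ω => ∑ k ∈ Finset.range n, Y k ω) := by
  have := hindep.isProbabilityMeasure
  have : IsProbabilityMeasure μ := hlaw 0 ▸ Measure.isProbabilityMeasure_map (hY 0)
  by_contra hni
  have h1 := complexMGF_map_sum hindep hY hlaw n t
  rw [complexMGF_ofReal, complexMGF_ofReal, mgf_undef (X := id) hni] at h1
  have h2 : 0 < mgf id μ t := mgf_pos hi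
  have h3 : (0 : ℝ) = mgf id μ t ^ n := by exact_mod_cast h1
  exact (pow_pos h2 n).ne h3

end Sums

/-! ### Rescaling and conclusion -/

theorem map_div_sqrt_le_smul_gaussianReal {σ : Measure ℝ} {c : ℝ≥0∞} {n : ℕ} (hn : 0 < n)
    (h : σ ≤ c • gaussianReal 0 n) : σ.map (fun x => x / √n) ≤ c • gaussianReal 0 1 := by
  have hg : Measurable fun x : ℝ => x / √n := by fun_prop
  refine (Measure.map_mono h hg).trans (le_of_eq ?_)
  rw [Measure.map_smul, gaussianReal_map_div_const]
  congr 2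
  · simp
  · ext
    have : (0 : ℝ) < n := by exact_mod_cast hn
    simp [this.ne']

theorem tendsto_sqrt_mul_pow_sub_two {r : ℝ} (hr0 : 0 < r) (hr1 : r < 1) (C : ℝ) :
    Tendsto (fun n : ℕ => √n * r ^ (n - 2) * C) atTop (𝓝 0) := by
  have h1 : Tendsto (fun n : ℕ => (n * r ^ n : ℝ)) atTop (𝓝 0) :=
    tendsto_self_mul_const_pow_of_lt_one hr0.le hr1
  have h2 : Tendsto (fun n : ℕ => √n * r ^ n) atTop (𝓝 0) := by
    refine squeeze_zero' (.of_forall fun n => by positivity) ?_ h1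
    filter_upwards [eventually_ge_atTop 1] with n hn
    gcongr
    have : (1 : ℝ) ≤ n := by exact_mod_cast hn
    exact Real.sqrt_le_iff.2 ⟨by positivity, by nlinarith⟩
  have h3 := h2.mul_const ((r ^ 2)⁻¹ * C)
  rw [zero_mul] at h3
  refine h3.congr' ?_
  filter_upwards [eventually_ge_atTop 2] with n hn
  rw [show r ^ n = r ^ (n - 2) * r ^ 2 by rw [← pow_add, Nat.sub_add_cancel hn]]
  field_simp

theorem corollary8p1
    {Ω : Type*} [MeasurableSpace Ω] (P : Measure Ω) [IsProbabilityMeasure P]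
    (X : Ω → ℝ)
    (hpdf : HasPDF X P volume)
    (hmean : ∫ ω, X ω ∂P = 0)
    (hvar : variance X P = 1)
    (hT : tsallisInfty (densityReal X P) < ⊤)
    (hsep : SeparationProperty X P)
    {Ω' : Type*} [MeasurableSpace Ω'] (P' : Measure Ω') [IsProbabilityMeasure P']
    (Xs : ℕ → Ω' → ℝ)
    (hindep : iIndepFun Xs P')
    (hident : ∀ k, IdentDistrib (Xs k) X P' P) :
    (∀ n : ℕ, 1 ≤ n → HasPDF (normalizedSum Xs n) P' volume) ∧
    Tendsto (fun n : ℕ => tsallisInfty (densityReal (normalizedSum Xs n) P')) atTop (𝓝 0) := by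
  have hX : AEMeasurable X P := hpdf.aemeasurable
  have hY : ∀ k, AEMeasurable (Xs k) P' := fun k => (hident k).aemeasurable_fst
  have hlaw : ∀ k, P'.map (Xs k) = P.map X := fun k => (hident k).map_eq
  have hac : P.map X ≪ volume := hpdf.absolutelyContinuous
  have hZ : ∀ n : ℕ, 1 ≤ n → HasPDF (normalizedSum Xs n) P' volume := fun n hn =>
    hasPDF_normalizedSum hindep hY (fun k => by rw [hlaw k]; exact hac) hn
  refine ⟨hZ, ?_⟩
  obtain ⟨C, hC, hμ⟩ := exists_map_le_smul_gaussianReal_of_tsallisInfty_lt_top hpdf hT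
  have h1 : ∫ x, x ∂(P.map X) = 0 := by
    rw [integral_map hX (by fun_prop), hmean]
  have h2 : ∫ x, x ^ 2 ∂(P.map X) = 1 := by
    rw [integral_map hX (by fun_prop), ← hvar, variance_eq_integral hX, hmean]
    simp
  have hmgf : ∀ t, mgf id (P.map X) t = mgf X P t := fun t => by rw [mgf_id_map hX]
  have : IsProbabilityMeasure (P.map X) := Measure.isProbabilityMeasure_map hX
  set μ := P.map X with hμdef
  have hi : ∀ t, Integrable (fun x => Real.exp (t * x)) μ := fun t =>
    ((integrable_exp_mul_gaussianReal t).smul_measure ENNReal.ofReal_ne_top).mono_measure hμ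
  have hK : Integrable (fun x => Real.exp (2 * |x|)) μ :=
    integrable_exp_mul_abs (X := id) (hi 2) (hi (-2))
  have hsep' : ∀ t₀ : ℝ, 0 < t₀ → ∃ δ : ℝ, 0 < δ ∧ δ < 1 ∧ ∀ t : ℝ, t₀ ≤ |t| →
      mgf id μ t ≤ (1 - δ) * Real.exp (t ^ 2 / 2) := by
    intro t₀ ht₀
    obtain ⟨δ, hδ, hδ1, H⟩ := hsep t₀ ht₀
    exact ⟨δ, hδ, hδ1, fun t ht => by rw [hmgf]; exact (H t ht).2⟩
  have hbound : ∀ c : ℝ, 0 < c → ∀ᶠ n : ℕ in atTop,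
      tsallisInfty (densityReal (normalizedSum Xs n) P') ≤ c := by
    intro c hc
    -- Half of the allowance c goes to (1-ε)^{-1/2}, the other half to the geometrically small term;
    -- δ and C do not depend on n.
    obtain ⟨ε, hε, hε1, hεc⟩ : ∃ ε : ℝ, 0 < ε ∧ ε < 1 ∧ (√(1 - ε))⁻¹ = 1 + c / 2 := by
      have hlt : ((1 + c / 2) ^ 2)⁻¹ < 1 := inv_lt_one_of_one_lt₀ (by nlinarith)
      have hpos : 0 < ((1 + c / 2) ^ 2)⁻¹ := by positivity
      refine ⟨1 - ((1 + c / 2) ^ 2)⁻¹, by linarith, by linarith, ?_⟩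
      rw [sub_sub_cancel, Real.sqrt_inv, inv_inv, Real.sqrt_sq (by positivity)]
    obtain ⟨δ, hδ, hδ1, hdich⟩ := exists_norm_complexMGF_dichotomy hac hK h1 h2 hsep' hε hε1
    have hlim := tendsto_sqrt_mul_pow_sub_two (r := 1 - δ) (by linarith) (by linarith) C
    filter_upwards [eventually_ge_atTop 2,
      hlim.eventually_le_const (by positivity : 0 < c / 2)] with n hn hsmall
    have hSm : AEMeasurable (fun ω => ∑ k ∈ Finset.range n, Xs k ω) P' := by fun_prop
    have : IsProbabilityMeasure (P'.map fun ω => ∑ k ∈ Finset.range n, Xs k ω) :=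
      Measure.isProbabilityMeasure_map hSm
    have hS := le_smul_gaussianReal_of_complexMGF_eq_pow hC hμ hi (mgf_le_of_separation hsep')
      hε1 hδ1 hdich hn
      (fun t => integrable_exp_map_sum hindep hY hlaw (hi t) n)
      (complexMGF_map_sum hindep hY hlaw n)
    have hZle := map_div_sqrt_le_smul_gaussianReal (by omega) hS
    rw [← map_normalizedSum hY] at hZle
    refine tsallisInfty_le_of_map_le_smul_gaussianReal (hZ n (by omega)) (by linarith)
      (hZle.trans ?_)
    have hconst : (√(1 - ε))⁻¹ + √n * (1 - δ) ^ (n - 2) * C ≤ 1 + c := by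
      rw [hεc]; linarith
    intro s
    simp only [Measure.smul_apply, smul_eq_mul]
    gcongr
  -- The lower side is nonnegativity; the upper side inserts a real c between 0 and the extended
  -- real `a`.
  refine tendsto_order.2 ⟨fun a ha => ?_, fun a ha => ?_⟩
  · filter_upwards [eventually_ge_atTop 1] with n hn
    exact ha.trans_le (tsallisInfty_nonneg (hZ n hn))
  · obtain ⟨c, hc0, hca⟩ := EReal.lt_iff_exists_real_btwn.1 ha
    filter_upwards [hbound c (by exact_mod_cast hc0)] with n hn
    exact hn.trans_lt hca
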